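/- Let $V$ be a geodesic space (a metric space in which each distance is realized by the length of a path), let $X\subset V$ be finite, and let $K\subset V$ satisfy $X\subset K^\circ$ and $\overline{K^\circ}=K$. Fix a field $F$; $H_n$ is simplicial homology with coefficients in $F$. **Complexes.** For $\alpha\ge 0$ let $R(X,K)_\alpha$ be the simplicial complex of the nonempty $Y\subseteq X$ such that $B_\alpha(x)\cap B_\alpha(y)\cap K\neq\emptyset$ for all distinct $x,y\in Y$ (it is empty for $\alpha<0$). Here $B_\alpha(x)$ is either the closed ball of the metric of $V$, or the set of points that can be reached from $x$ by a path inside $K$ of length at most $\alpha$; the statement holds for each of the two readings. Put $\rho_K(Y)=\inf\{\alpha: Y\in R(X,K)_\alpha\}$, with $\inf\emptyset=\infty$; write $R=R(X,V)$ and $\rho_V$ for the case $K=V$. Let $P_{\alpha,\varepsilon}$ be the subcomplex of the $Y\in R_\alpha$ all of whose nonempty faces $Z\subseteq Y$ satisfy $\rho_V(Z)\le\rho_K(Z)\le\alpha$ and $\rho_K(Z)\le\rho_V(Z)+\varepsilon$. A *Rips-like path* is a filtration $L_\alpha=P_{\alpha,\varepsilon(\alpha)}$, where $\varepsilon$ is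 non-decreasing on $[0,\infty)$ and $\varepsilon(0)=0$. Write $HR_\alpha$, $HP_{\alpha,\varepsilon}$, $HL_\alpha$ for the homology (in all degrees $n\ge 0$). **Matching.** $X,K$ are $\lambda$-*locally simplicially matched* ($\lambda$-LSM) if $P_{t,0}=R_t$ for all $t\le\lambda$; let $\lambda_{\sup}\in[-\infty,\infty]$ be the supremum of such $\lambda$. For real numbers $0\le\lambda<\lambda_{\sup}<\delta\le\omega$, $X,K$ are $(\lambda,\delta,\omega)$-*homologically matched* if for some $0\le\varepsilon_1\le\varepsilon_2$ one has, in every degree, $\ker(HR_\lambda\to HR_\delta)\subseteq\ker(HP_{\lambda,\varepsilon_1}\to HP_{\omega,\varepsilon_2})$, where $HR_\lambda=HP_{\lambda,\varepsilon_1}$ through the inclusion $P_{\lambda,\varepsilon_1}=R_\lambda$. **Diagrams.** For a persistence module $M$ indexed by $\mathbb R$ let $r(s,t)=\operatorname{rank}(M_s\to M_t)$. The multiplicity of the dot $(b,d)$, $b<d<\infty$, in the persistence diagram of $M$ is the minimum of $r(b',c)-r(a,c)-r(b',d')+r(a,d')$ over $a<b<b'\le c<d<d'$; that of $(b,\infty)$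 is the minimum of $r(b',c)-r(a,c)$ over $a<b<b'\le c$. Call *older than $b$* the elements of $M_t$ in the span of the images of the $M_s$, $s<b$. A class $y\in M_b$ *dies at* $d\in[b,\infty]$ if $d$ is the infimum of the $t\ge b$ at which the image of $y$ in $M_t$ is older than $b$ (in particular, at which it is zero). **Lemma (Matching Lemma).** Suppose that distinct pairs of distinct points of $X$ have distinct distances in $V$, and that $X,K$ are $(\lambda,\delta,\omega)$-homologically matched. Then there is a Rips-like path $L$ for which, in every degree $n$, each dot $(b,d)$ of the persistence diagram of $L$ with $b\le\lambda<\omega<d$ corresponds via $\lambda$-LSM to a dot $(b,c)$ of the persistence diagram of $R$ with $b\le\lambda<\delta<c$. Precisely: for every degree $n$ and every $b\le\lambda$ there are a bijection $\Phi$ from the dots with birth $b$ (with multiplicity) of the persistence diagram of $HL$ onto those of $HR$, and a class $y_p\in HL_b$ for each dot $p=(b,d)$ of $HL$, such that 1. the classes $y_p$ form a basis of $HL_b$ modulo the classes older than $b$; 2. if $p=(b,d)$ and $\Phi(p)=(b,c)$, then $y_p$ dies at $d$ in $HL$, and its image under the map $HL_b\to HR_b$ induced by $L_b\subseteq R_b$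 dies at $c$ in $HR$; 3. if $p=(b,d)$ with $d>\omega$ and $\Phi(p)=(b,c)$, then $c>\delta$. -/

import Mathlib

open CategoryTheory

universe u v

noncomputable section

namespace Parallax

/-! ### Geodesic spaces, models and Rips complexes -/

/-- A metric space in which each distance is realized by (the length of) a path. -/
def IsGeodesicSpace (V : Type u) [MetricSpace V] : Prop :=
  ∀ x y : V, ∃ γ : Path x y, eVariationOn γ Set.univ = edist x y

/-- `K` is a model of the finite dataset `X`: the points of `X` are interior to `K`, and `K` is
the closure of its interior. -/
def IsModel {V : Type u} [MetricSpace V] (X : Finset V) (K : Set V) : Prop :=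
  (X : Set V) ⊆ interior K ∧ closure (interior K) = K

/-- The two ways of measuring the balls `B_α(x)` in the Rips complex of a model `K`: with the
metric of the ambient space, or with lengths of paths inside `K`. They agree for `K = V` when `V`
is a geodesic space. -/
inductive BallKind
  | ambient
  | intrinsic

/-- The closed ball `B_α(x)`. In the intrinsic case it consists of the points that can be reached
from `x` by a path of length at most `α` inside `K`. -/
def ball {V : Type u} [MetricSpace V] (k : BallKind) (K : Set V) (x : V) (α : ℝ) : Set V :=
  match k with
  | .ambient => Metric.closedBall x α
  | .intrinsic =>
      {z | ∃ γ : Path x z, (∀ t, γ t ∈ K) ∧ eVariationOn γ Set.univ ≤ ENNReal.ofReal α}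

/-- The Rips complex `R(X,K)_α`, empty for `α < 0`. -/
def rips {V : Type u} [MetricSpace V] (k : BallKind) (X : Finset V) (K : Set V) (α : ℝ) :
    PreAbstractSimplicialComplex V where
  faces := {Y | Y.Nonempty ∧ Y ⊆ X ∧ 0 ≤ α ∧
    ∀ x ∈ Y, ∀ y ∈ Y, x ≠ y → (ball k K x α ∩ ball k K y α ∩ K).Nonempty}
  isRelLowerSet_faces := fun _ h => ⟨h.1, fun _ hZ hne =>
    ⟨hne, hZ.trans h.2.1, h.2.2.1, fun x hx y hy => h.2.2.2 x (hZ hx) y (hZ hy)⟩⟩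

/-- `ρ_K(Y)`, the least `α` with `Y ∈ R(X,K)_α` (`⊤` if there is none). -/
def rho {V : Type u} [MetricSpace V] (k : BallKind) (X : Finset V) (K : Set V) (Y : Finset V) :
    EReal :=
  ⨅ (α : ℝ) (_ : Y ∈ rips k X K α), (α : EReal)

/-- The parallax complex `P(X,K,V)_{α,ε}`: the subcomplex of the ambient Rips complex made of the
simplices all of whose faces `Z` satisfy `ρ_V(Z) ≤ ρ_K(Z) ≤ α` and `ρ_K(Z) ≤ ρ_V(Z) + ε`. -/
def parallax {V : Type u} [MetricSpace V] (k : BallKind) (X : Finset V) (K : Set V) (α ε : ℝ) :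
    PreAbstractSimplicialComplex V where
  faces := {Y | Y ∈ rips k X Set.univ α ∧ ∀ Z ⊆ Y, Z.Nonempty →
    rho k X Set.univ Z ≤ rho k X K Z ∧ rho k X K Z ≤ (α : EReal) ∧
      rho k X K Z ≤ rho k X Set.univ Z + (ε : EReal)}
  isRelLowerSet_faces := fun _ h => ⟨h.1.1, fun _ hZ hne =>
    ⟨((rips k X Set.univ α).isRelLowerSet_faces h.1).2 hZ hne,
      fun W hW => h.2 W (hW.trans hZ)⟩⟩

section Monotone

variable {V : Type u} [MetricSpace V] {k : BallKind} {X : Finset V} {K : Set V}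

theorem ball_mono (x : V) {α β : ℝ} (h : α ≤ β) : ball k K x α ⊆ ball k K x β := by
  cases k with
  | ambient => exact Metric.closedBall_subset_closedBall h
  | intrinsic =>
    rintro z ⟨γ, hγ, hl⟩
    exact ⟨γ, hγ, hl.trans (ENNReal.ofReal_le_ofReal h)⟩

theorem rips_mono : Monotone (rips k X K) := by
  intro α β h Y hY
  refine ⟨hY.1, hY.2.1, hY.2.2.1.trans h, fun x hx y hy hxy => ?_⟩
  refine (hY.2.2.2 x hx y hy hxy).mono ?_
  exact Set.inter_subset_inter_left _ (Set.inter_subset_inter (ball_mono x h) (ball_mono y h))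

theorem parallax_le_rips (α ε : ℝ) : parallax k X K α ε ≤ rips k X Set.univ α :=
  fun _ hY => hY.1

theorem parallax_mono {α β ε ε' : ℝ} (hα : α ≤ β) (hε : 0 ≤ α → ε ≤ ε') :
    parallax k X K α ε ≤ parallax k X K β ε' := by
  intro Y hY
  refine ⟨rips_mono hα hY.1, fun Z hZ hne => ?_⟩
  obtain ⟨h1, h2, h3⟩ := hY.2 Z hZ hne
  refine ⟨h1, h2.trans (EReal.coe_le_coe_iff.2 hα), h3.trans ?_⟩
  gcongr
  exact hε hY.1.2.2.1

end Monotone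

/-! ### Simplicial homology -/

section Homology

variable (F : Type v) [Field F] {V : Type u}

variable (V) in
/-- The free vector space on the `m`-tuples of points of `V`. -/
def Chain (m : ℕ) : Type (max u v) := (Fin m → V) →₀ F

instance (m : ℕ) : AddCommGroup (Chain F V m) :=
  inferInstanceAs (AddCommGroup ((Fin m → V) →₀ F))

instance (m : ℕ) : Module F (Chain F V m) :=
  inferInstanceAs (Module F ((Fin m → V) →₀ F))

/-- The tuple `x`, with coefficient `a`, as a chain. -/
def Chain.single {m : ℕ} (x : Fin m → V) (a : F) : Chain F V m := Finsupp.single x a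

/-- The alternating sum of the faces of an ordered `n`-simplex, extended linearly. -/
def boundary (n : ℕ) : Chain F V (n + 1) →ₗ[F] Chain F V n :=
  Finsupp.linearCombination F fun x : Fin (n + 1) → V =>
    ∑ i : Fin (n + 1), Chain.single F (fun j => x (i.succAbove j)) ((-1 : F) ^ (i : ℕ))

/-- The ordered `n`-chains of `S`: combinations of tuples of vertices that span a face of `S`. -/
def chains (S : PreAbstractSimplicialComplex V) (n : ℕ) : Submodule F (Chain F V (n + 1)) :=
  Submodule.span F {c | ∃ x : Fin (n + 1) → V,
    (∃ Y ∈ S, (Y : Set V) = Set.range x) ∧ c = Chain.single F x 1}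

/-- The `n`-cycles of `S`; every `0`-chain is a cycle. -/
def cycles (S : PreAbstractSimplicialComplex V) : (n : ℕ) → Submodule F (Chain F V (n + 1))
  | 0 => chains F S 0
  | n + 1 => chains F S (n + 1) ⊓ LinearMap.ker (boundary F (n + 1))

/-- The `n`-boundaries of `S`. -/
def boundaries (S : PreAbstractSimplicialComplex V) (n : ℕ) : Submodule F (Chain F V (n + 1)) :=
  (chains F S (n + 1)).map (boundary F (n + 1))

/-- The (unreduced) simplicial homology `H_n(S; F)`, computed by ordered chains. -/
abbrev Homology (n : ℕ) (S : PreAbstractSimplicialComplex V) : Type (max u v) :=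
  cycles F S n ⧸ (boundaries F S n).submoduleOf (cycles F S n)

variable {S T : PreAbstractSimplicialComplex V}

theorem chains_mono (h : S ≤ T) (n : ℕ) : chains F S n ≤ chains F T n :=
  Submodule.span_mono fun _ ⟨x, ⟨Y, hY, hx⟩, hc⟩ => ⟨x, ⟨Y, h hY, hx⟩, hc⟩

theorem cycles_mono (h : S ≤ T) (n : ℕ) : cycles F S n ≤ cycles F T n := by
  cases n with
  | zero => exact chains_mono F h 0
  | succ n => exact inf_le_inf_right _ (chains_mono F h _)

theorem boundaries_mono (h : S ≤ T) (n : ℕ) : boundaries F S n ≤ boundaries F T n :=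
  Submodule.map_mono (chains_mono F h _)

/-- The map induced in homology by an inclusion `S ≤ T`. -/
def homologyMap (n : ℕ) (h : S ≤ T) : Homology F n S →ₗ[F] Homology F n T :=
  Submodule.mapQ _ _ (Submodule.inclusion (cycles_mono F h n))
    fun _ hx => boundaries_mono F h n hx

variable (V) in
/-- Simplicial homology as a functor on the simplicial complexes with vertices in `V`. -/
def homologyFunctor (n : ℕ) : PreAbstractSimplicialComplex V ⥤ ModuleCat.{max u v} F where
  obj S := ModuleCat.of F (Homology F n S)
  map f := ModuleCat.ofHom (homologyMap F n (leOfHom f))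
  map_id S := by
    ext x
    rfl
  map_comp f g := by
    ext x
    rfl

end Homology

/-! ### Persistence modules and their diagrams -/

section Persistence

variable {F : Type v} [Field F]

/-- The transition map `M_s → M_t` of a persistence module. -/
def transition (M : ℝ ⥤ ModuleCat.{u} F) {s t : ℝ} (h : s ≤ t) : M.obj s →ₗ[F] M.obj t :=
  (M.map (homOfLE h)).hom

/-- The rank of `M_s → M_t`. -/
def rank (M : ℝ ⥤ ModuleCat.{u} F) (s t : ℝ) : ℕ :=
  if h : s ≤ t then Module.finrank F (LinearMap.range (transition M h)) else 0

/-- The multiplicity of the dot `(b,d)`, `b < d ≤ ∞`, in the persistence diagram of `M`: the least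
number of bars counted by a rectangle `(a,b'] × (c,d']`, or `(a,b'] × (c,∞]` when `d = ∞`, that
contains `(b,d)` in its interior. The number of bars that are born in `(a,b']` and die in `(c,d']`
is the alternating sum of ranks at the corners. It is `0` if `d ≤ b`. -/
def multiplicity (M : ℝ ⥤ ModuleCat.{u} F) (b : ℝ) (d : EReal) : ℕ :=
  sInf {m | ∃ a b' c : ℝ, a < b ∧ b < b' ∧ b' ≤ c ∧ (c : EReal) < d ∧
    ((∃ d' : ℝ, d < (d' : EReal) ∧
        m = rank M b' c + rank M a d' - (rank M a c + rank M b' d')) ∨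
      (d = ⊤ ∧ m = rank M b' c - rank M a c))}

/-- The dots of the persistence diagram of `M` with birth `b`, repeated according to multiplicity.
The first component of a dot is its death. -/
abbrev DotsAt (M : ℝ ⥤ ModuleCat.{u} F) (b : ℝ) : Type :=
  Σ d : EReal, Fin (multiplicity M b d)

/-- The classes in `M_t` that come from classes older than `b`. -/
def older (M : ℝ ⥤ ModuleCat.{u} F) {b t : ℝ} (h : b ≤ t) : Submodule F (M.obj t) :=
  ⨆ (s : ℝ) (hs : s < b), LinearMap.range (transition M (hs.le.trans h))

/-- The class `y ∈ M_b` dies at `d`: this is the first parameter at which `y` becomes zero or,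
more generally, merges with a class older than `b` (`d = ∞` if this never happens). -/
def DiesAt (M : ℝ ⥤ ModuleCat.{u} F) {b : ℝ} (y : M.obj b) (d : EReal) : Prop :=
  d = ⨅ (t : ℝ) (h : b ≤ t) (_ : transition M h y ∈ older M h), (t : EReal)

end Persistence

/-! ### Rips-like paths, local simplicial matching and homological matching -/

/-- The data `ε(α)`, `0 ≤ α < ∞`, of a Rips-like path (the values at `α < 0` play no role). -/
structure RipsLikePath where
  eps : ℝ → ℝ
  mono : MonotoneOn eps (Set.Ici 0)
  zero : eps 0 = 0

section Filtrations

variable {V : Type u} [MetricSpace V]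

/-- The filtration `L_α = P_{α,ε(α)}`. -/
def RipsLikePath.filtration (L : RipsLikePath) (k : BallKind) (X : Finset V) (K : Set V) :
    ℝ →o PreAbstractSimplicialComplex V where
  toFun α := parallax k X K α (L.eps α)
  monotone' _ _ h := parallax_mono h fun h0 => L.mono h0 (h0.trans h) h

/-- The homology `HL` of a Rips-like path in degree `n`. -/
def HL (F : Type v) [Field F] (n : ℕ) (k : BallKind) (X : Finset V) (K : Set V)
    (L : RipsLikePath) : ℝ ⥤ ModuleCat.{max u v} F :=
  (L.filtration k X K).monotone.functor ⋙ homologyFunctor F V n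

/-- The homology `HR` of the ambient Rips complex `R = R(X,V)` in degree `n`. -/
def HR (F : Type v) [Field F] (n : ℕ) (k : BallKind) (X : Finset V) :
    ℝ ⥤ ModuleCat.{max u v} F :=
  (rips_mono (k := k) (X := X) (K := Set.univ)).functor ⋙ homologyFunctor F V n

/-- The map `HL_b → HR_b` induced by the inclusion `L_b ⊆ R_b`. -/
def toHR (F : Type v) [Field F] (n : ℕ) (k : BallKind) (X : Finset V) (K : Set V)
    (L : RipsLikePath) (b : ℝ) : (HL F n k X K L).obj b →ₗ[F] (HR F n k X).obj b :=
  homologyMap F n (parallax_le_rips (k := k) (X := X) (K := K) b (L.eps b))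

/-- `X` and `K` are `lam`-locally simplicially matched. -/
def LSM (k : BallKind) (X : Finset V) (K : Set V) (lam : ℝ) : Prop :=
  ∀ t ≤ lam, parallax k X K t 0 = rips k X Set.univ t

/-- `λ_sup`, the supremum of the `lam` for which `X` and `K` are `lam`-locally simplicially
matched. -/
def lamSup (k : BallKind) (X : Finset V) (K : Set V) : EReal :=
  ⨆ (lam : ℝ) (_ : LSM k X K lam), (lam : EReal)

/-- `X` and `K` are `(lam, δ, ω)`-homologically matched, for homology with coefficients in `F`.
As `lam < λ_sup`, the inclusion `P_{lam,ε₁} ⊆ R_lam` is an equality; the kernel of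
`HR_lam → HR_δ` is transported to `HP_{lam,ε₁}` along it. -/
structure HomologicallyMatched (F : Type v) [Field F] (k : BallKind) (X : Finset V) (K : Set V)
    (lam δ ω : ℝ) : Prop where
  nonneg : 0 ≤ lam
  lt_sup : (lam : EReal) < lamSup k X K
  sup_lt : lamSup k X K < (δ : EReal)
  le : δ ≤ ω
  ker_le : ∃ (ε₁ ε₂ : ℝ) (_ : 0 ≤ ε₁) (hε : ε₁ ≤ ε₂), ∀ n : ℕ,
    (LinearMap.ker (homologyMap F n (rips_mono (k := k) (X := X) (K := Set.univ)
        (EReal.coe_lt_coe_iff.1 (lt_sup.trans sup_lt)).le))).comap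
      (homologyMap F n (parallax_le_rips (k := k) (X := X) (K := K) lam ε₁)) ≤
    LinearMap.ker (homologyMap F n (parallax_mono (k := k) (X := X) (K := K)
        ((EReal.coe_lt_coe_iff.1 (lt_sup.trans sup_lt)).le.trans le) fun _ => hε))

end Filtrations

end Parallax

end

noncomputable section

namespace Parallax

/-! ### Bases adapted to two ultrametric functions -/

/-! Since `lam < lamSup`, local simplicial matching holds up to some `l > lam`. Take for `L` the
path with `ε = 0` up to `l` and `ε = ε₂` afterwards. Then `L_t = R_t` for `t ≤ l`, so for `b ≤ lam`
the spaces `HL_b` and `HR_b` are identified, with the same older classes. What differs is the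
future: each of the two filtrations assigns a death to every class of this one space.

Both deaths are ultrametric functions, that is, two filtrations by subspaces of one
finite-dimensional space. As with two flags, there is a basis adapted to both
(`exists_adapted_basis`). In a tame module the multiplicity of `(b,d)` is the jump at `d` of the
dimension of the space of classes dying by `d` (`multiplicity_add_finrank`), and an adapted basis
counts this jump. So each common basis vector that is not older than `b` carries one dot of `HL` and
one of `HR`; this defines `Φ` and the representatives at once (`exists_compatible_dots`).

For the last claim, let `y` represent a dot whose partner dies by `δ`. Then `y` agrees in `HR_δ`
with an older class `z`, so `z - y`, moved to `lam`, lies in the kernel of `HR_lam → HR_δ`.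
Homological matching makes it vanish in `HP_{ω,ε₂} = HL_ω`; hence `y` is already dead at `ω` in `L`
(`dead_of_homologicallyMatched`). -/

/-- A function on a vector space that satisfies the ultrametric inequality and does not grow under
scalar multiplication. -/
structure IsUltrametric (F : Type*) [Field F] {Q : Type*} [AddCommGroup Q] [Module F Q]
    {ι : Type*} [LinearOrder ι] (v : Q → ι) : Prop where
  add_le : ∀ x y, v (x + y) ≤ max (v x) (v y)
  smul_le : ∀ (a : F) x, v (a • x) ≤ v x

/-- A basis is adapted to `v` if `v` of a combination bounds `v` of all basis vectors involved. -/
def IsAdapted {F : Type*} [Field F] {Q : Type*} [AddCommGroup Q] [Module F Q]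
    {ι : Type*} [LinearOrder ι] {κ : Type*} [Fintype κ] (v : Q → ι) (e : κ → Q) : Prop :=
  ∀ (a : κ → F) i, a i ≠ 0 → v (e i) ≤ v (∑ j, a j • e j)

section LinearAlgebra

variable {F : Type*} [Field F] {ι : Type*} [LinearOrder ι]

namespace IsUltrametric

variable {Q : Type*} [AddCommGroup Q] [Module F Q] {v : Q → ι}

theorem zero_le (hv : IsUltrametric F v) (x : Q) : v 0 ≤ v x := by
  simpa using hv.smul_le 0 x

theorem comp {Q' : Type*} [AddCommGroup Q'] [Module F Q'] (hv : IsUltrametric F v)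
    (f : Q' →ₗ[F] Q) : IsUltrametric F (fun x => v (f x)) where
  add_le x y := by simpa using hv.add_le (f x) (f y)
  smul_le a x := by simpa using hv.smul_le a (f x)

/-- The sublevel set `{v ≤ d}`. -/
def sublevel (hv : IsUltrametric F v) (d : ι) (hd : v 0 ≤ d) : Submodule F Q where
  carrier := {x | v x ≤ d}
  zero_mem' := hd
  add_mem' hx hy := (hv.add_le _ _).trans (max_le hx hy)
  smul_mem' a _ hx := (hv.smul_le a _).trans hx

/-- The strict sublevel set `{v < d}`. -/
def strictSublevel (hv : IsUltrametric F v) (d : ι) (hd : v 0 < d) : Submodule F Q where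
  carrier := {x | v x < d}
  zero_mem' := hd
  add_mem' hx hy := (hv.add_le _ _).trans_lt (max_lt hx hy)
  smul_mem' a _ hx := (hv.smul_le a _).trans_lt hx

theorem sublevel_lt (hv : IsUltrametric F v) {x z : Q} (h : v x < v z) :
    hv.sublevel (v x) (hv.zero_le x) < hv.sublevel (v z) (hv.zero_le z) :=
  SetLike.lt_iff_le_and_exists.2 ⟨fun _ hy => le_trans hy h.le, z, le_refl (v z), not_le.2 h⟩

/-- Larger values have strictly larger sublevel subspaces, and strict chains of subspaces terminate
in finite dimension. Extrema are therefore attained without any assumption on the ordered set of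
values. -/
theorem exists_min [Module.Finite F Q] (hv : IsUltrametric F v) {s : Set Q} (hs : s.Nonempty) :
    ∃ z ∈ s, ∀ x ∈ s, v z ≤ v x := by
  obtain ⟨z, hz, h⟩ := (InvImage.wf (fun x => hv.sublevel (v x) (hv.zero_le x)) wellFounded_lt).has_min s hs
  exact ⟨z, hz, fun x hx => not_lt.1 fun hlt => h x hx (hv.sublevel_lt hlt)⟩

theorem exists_max [Module.Finite F Q] (hv : IsUltrametric F v) : ∃ z, ∀ x, v x ≤ v z := by
  obtain ⟨z, -, h⟩ := (InvImage.wf (fun x => hv.sublevel (v x) (hv.zero_le x)) wellFounded_gt).has_min Set.univ ⟨0, trivial⟩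
  exact ⟨z, fun x => not_lt.1 fun hlt => h x trivial (hv.sublevel_lt hlt)⟩

/-- Outside a suitable hyperplane, an ultrametric function is constant and maximal. -/
theorem exists_functional [Module.Finite F Q] [Nontrivial Q] (hv : IsUltrametric F v) :
    ∃ f : Q →ₗ[F] F, f ≠ 0 ∧ ∀ x, f x ≠ 0 → ∀ z, v z ≤ v x := by
  obtain ⟨z, hz⟩ := hv.exists_max
  obtain ⟨S, hS, h⟩ : ∃ S : Submodule F Q, S < ⊤ ∧ ∀ x ∉ S, v z ≤ v x := by
    -- If `v` is not constant, the classes below its maximum form a proper subspace, and any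
    -- hyperplane containing it will do. If `v` is constant, every hyperplane will do.
    by_cases h0 : v 0 < v z
    · refine ⟨hv.strictSublevel (v z) h0, ?_, fun x hx => not_lt.1 hx⟩
      exact lt_top_iff_ne_top.2 fun h => lt_irrefl (v z) ((Submodule.eq_top_iff'.1 h) z)
    · exact ⟨⊥, bot_lt_top, fun x _ => (not_lt.1 h0).trans (hv.zero_le x)⟩
  obtain ⟨f, hf, hSf⟩ := Submodule.exists_le_ker_of_lt_top S hS
  exact ⟨f, hf, fun x hx y => (hz y).trans (h x fun hxS => hx (hSf hxS))⟩

/-- The induction step for adapted families. -/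
theorem isAdapted_cons (hv : IsUltrametric F v) {H : Submodule F Q} {n : ℕ} {e : Fin n → H} {y : Q}
    (he : IsAdapted (F := F) (fun x : H => v x) e)
    (hy : ∀ (a : F) (x : H), a ≠ 0 → v y ≤ v (a • y + x)) :
    IsAdapted (F := F) v (Fin.cons y (Subtype.val ∘ e) : Fin (n + 1) → Q) := by
  intro a i hi
  have hsum : ∑ j, a j • (Fin.cons y (Subtype.val ∘ e) : Fin (n + 1) → Q) j =
      a 0 • y + ((∑ j, a j.succ • e j : H) : Q) := by
    simp [Fin.sum_univ_succ]
  rw [hsum]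
  set h : H := ∑ j, a j.succ • e j with hh
  -- The hyperplane component `h` is the whole vector minus `a 0 • y`, and neither of these exceeds
  -- `v (a 0 • y + h)`.
  have key : v (h : Q) ≤ v (a 0 • y + h) := by
    rcases eq_or_ne (a 0) 0 with h0 | h0
    · simp [h0]
    · have h1 := hv.add_le (a 0 • y + h) ((-a 0) • y)
      rw [show a 0 • y + (h : Q) + (-a 0) • y = h by rw [neg_smul]; abel] at h1
      exact h1.trans (max_le le_rfl ((hv.smul_le _ _).trans (hy _ h h0)))
  induction i using Fin.cases with
  | zero => exact hy _ h hi
  | succ i => exact (he (fun j => a j.succ) i hi).trans key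

end IsUltrametric

/-- Two ultrametric functions on a finite-dimensional space have a common adapted basis. -/
theorem exists_adapted_basis (n : ℕ) : ∀ {Q : Type u} [AddCommGroup Q] [Module F Q]
    [Module.Finite F Q] {v w : Q → ι}, IsUltrametric F v → IsUltrametric F w →
    Module.finrank F Q = n →
    ∃ e : Module.Basis (Fin n) F Q, IsAdapted (F := F) v e ∧ IsAdapted (F := F) w e := by
  induction n with
  | zero =>
    intro Q _ _ _ v w hv hw hn
    exact ⟨Module.finBasisOfFinrankEq F Q hn, fun _ i => i.elim0, fun _ i => i.elim0⟩
  | succ n ih =>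
    intro Q _ _ _ v w hv hw hn
    have : Nontrivial Q := Module.nontrivial_of_finrank_pos (R := F) (by omega)
    obtain ⟨f, hf, hmax⟩ := hv.exists_functional
    -- One hyperplane serves both functions: outside it `v` is constant, so any `y` there suits `v`,
    -- and `y` is free to be chosen with least `w`.
    obtain ⟨y, hy, hmin⟩ := hw.exists_min (s := {x | f x ≠ 0})
      (by by_contra h; exact hf (LinearMap.ext fun x => by_contra fun hx => h ⟨x, hx⟩))
    have hker : Module.finrank F (LinearMap.ker f) = n := by
      have h1 := LinearMap.finrank_range_add_finrank_ker f
      have h2 : LinearMap.range f = ⊤ := LinearMap.range_eq_top.2 (LinearMap.surjective hf)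
      rw [h2, finrank_top, Module.finrank_self] at h1
      omega
    obtain ⟨e, hev, hew⟩ := ih (hv.comp (LinearMap.ker f).subtype)
      (hw.comp (LinearMap.ker f).subtype) hker
    have hne : ∀ (a : F) (x : LinearMap.ker f), a ≠ 0 → f (a • y + x) ≠ 0 := by
      intro a x ha
      have := x.2
      rw [LinearMap.mem_ker] at this
      simpa [this] using ⟨ha, hy⟩
    refine ⟨Module.Basis.mkFinCons y e (fun c x hx h => ?_) (fun z => ⟨-(f z / f y), ?_⟩), ?_, ?_⟩
    · by_contra hc
      exact hne c ⟨x, hx⟩ hc (by simp [h])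
    · have : f y ≠ 0 := hy
      simp [this]
    · rw [Module.Basis.coe_mkFinCons]
      exact hv.isAdapted_cons hev fun a x ha => hmax _ (hne a x ha) _
    · rw [Module.Basis.coe_mkFinCons]
      exact hw.isAdapted_cons hew fun a x ha => hmin _ (hne a x ha)

/-- The dimension of a subspace that contains the basis vectors of each of its elements. -/
theorem finrank_eq_card_of_adapted {Q : Type*} [AddCommGroup Q] [Module F Q] {κ : Type*}
    [Fintype κ] (e : Module.Basis κ F Q) (S : Submodule F Q)
    (h : ∀ (a : κ → F) i, a i ≠ 0 → ∑ j, a j • e j ∈ S → e i ∈ S) :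
    Module.finrank F S = Nat.card {i // e i ∈ S} := by
  classical
  have hS : S = Submodule.span F (Set.range fun i : {i // e i ∈ S} => e i) := by
    apply le_antisymm
    · intro x hx
      rw [← e.sum_repr x] at hx ⊢
      refine Submodule.sum_mem _ fun i _ => ?_
      by_cases hi : e.repr x i = 0
      · simp [hi]
      · exact Submodule.smul_mem _ _ (Submodule.subset_span ⟨⟨i, h _ i hi hx⟩, rfl⟩)
    · rw [Submodule.span_le]
      rintro _ ⟨i, rfl⟩
      exact i.2
  conv_lhs => rw [hS]
  rw [Nat.card_eq_fintype_card]
  exact finrank_span_eq_card (e.linearIndependent.comp _ Subtype.val_injective)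

/-- The number of vectors of an adapted basis at which `v` takes the value `d`. -/
theorem card_fiber_of_adapted {Q : Type*} [AddCommGroup Q] [Module F Q] {κ : Type*}
    [Fintype κ] (e : Module.Basis κ F Q) {v : Q → ι} (he : IsAdapted (F := F) v e) {d : ι}
    {A B : Submodule F Q} (hA : ∀ x, x ∈ A ↔ v x ≤ d) (hB : ∀ x, x ∈ B ↔ v x < d) :
    Nat.card {i // v (e i) = d} + Module.finrank F B = Module.finrank F A := by
  classical
  rw [finrank_eq_card_of_adapted e A fun a i hi hx =>
      (hA _).2 ((he a i hi).trans ((hA _).1 hx)),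
    finrank_eq_card_of_adapted e B fun a i hi hx =>
      (hB _).2 ((he a i hi).trans_lt ((hB _).1 hx))]
  simp only [hA, hB, Nat.card_eq_fintype_card, Fintype.card_subtype]
  rw [← Finset.card_union_of_disjoint]
  · congr 1
    ext i
    simp [le_iff_eq_or_lt]
  · exact Finset.disjoint_filter.2 fun i _ h => by simp [h]

/-- The vectors of an adapted basis that lie outside a subspace form a basis of the quotient. -/
theorem linearIndependent_mkQ_of_adapted {Q : Type*} [AddCommGroup Q] [Module F Q] {κ : Type*}
    [Fintype κ] (e : Module.Basis κ F Q) (S : Submodule F Q)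
    (h : ∀ (a : κ → F) i, a i ≠ 0 → ∑ j, a j • e j ∈ S → e i ∈ S) :
    LinearIndependent F (fun i : {i // e i ∉ S} => S.mkQ (e i)) ∧
      Submodule.span F (Set.range fun i : {i // e i ∉ S} => S.mkQ (e i)) = ⊤ := by
  classical
  have hspan : Submodule.span F (Set.range fun i : {i // e i ∉ S} => S.mkQ (e i)) = ⊤ := by
    refine Submodule.eq_top_iff'.2 fun q => ?_
    obtain ⟨x, rfl⟩ := S.mkQ_surjective q
    rw [← e.sum_repr x, map_sum]
    refine Submodule.sum_mem _ fun i _ => ?_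
    rw [map_smul]
    refine Submodule.smul_mem _ _ ?_
    by_cases hi : e i ∈ S
    · rw [Submodule.mkQ_apply, (Submodule.Quotient.mk_eq_zero S).2 hi]
      exact Submodule.zero_mem _
    · exact Submodule.subset_span ⟨⟨i, hi⟩, rfl⟩
  refine ⟨linearIndependent_of_top_le_span_of_card_eq_finrank hspan.ge ?_, hspan⟩
  have : Module.Finite F Q := Module.Finite.of_basis e
  have h1 := finrank_eq_card_of_adapted e S h
  have h2 := S.finrank_quotient_add_finrank
  have h3 := Fintype.card_subtype_compl (fun i => e i ∈ S)
  have h4 := Fintype.card_subtype_le (fun i => e i ∈ S)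
  rw [Module.finrank_eq_card_basis e] at h2
  rw [Nat.card_eq_fintype_card] at h1
  omega

theorem finrank_map_add_finrank_inf_ker {Q Q' : Type*} [AddCommGroup Q] [Module F Q]
    [AddCommGroup Q'] [Module F Q'] [Module.Finite F Q] (g : Q →ₗ[F] Q') (A : Submodule F Q) :
    Module.finrank F (A.map g) + Module.finrank F (A ⊓ LinearMap.ker g : Submodule F Q) =
      Module.finrank F A := by
  rw [← LinearMap.finrank_range_add_finrank_ker (g.domRestrict A), LinearMap.range_domRestrict,
    LinearMap.ker_domRestrict]
  congr 1
  rw [← Submodule.map_comap_subtype]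
  exact Submodule.finrank_map_subtype_eq A _

end LinearAlgebra

/-! ### Deaths and multiplicities in tame persistence modules -/

section Persistence

variable {F : Type v} [Field F] {M N : ℝ ⥤ ModuleCat.{u} F}

theorem transition_transition {s t r : ℝ} (h : s ≤ t) (h' : t ≤ r) (x : M.obj s) :
    transition M h' (transition M h x) = transition M (h.trans h') x := by
  have : M.map (homOfLE (h.trans h')) = M.map (homOfLE h) ≫ M.map (homOfLE h') := by
    rw [← M.map_comp]; rfl
  simp [transition, this]

theorem transition_comp {s t r : ℝ} (h : s ≤ t) (h' : t ≤ r) :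
    transition M h' ∘ₗ transition M h = transition M (h.trans h') :=
  LinearMap.ext (transition_transition h h')

theorem transition_refl {s : ℝ} (x : M.obj s) : transition M (le_refl s) x = x := by
  simp [transition]

theorem range_transition_le {s t r : ℝ} (h : s ≤ t) (h' : t ≤ r) :
    LinearMap.range (transition M (h.trans h')) ≤ LinearMap.range (transition M h') := by
  rw [← transition_comp h h']
  exact LinearMap.range_comp_le_range _ _

theorem range_transition_eq {s t r : ℝ} (h : s ≤ t) (h' : t ≤ r)
    (hs : Function.Surjective (transition M h)) :
    LinearMap.range (transition M (h.trans h')) = LinearMap.range (transition M h') := by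
  rw [← transition_comp h h', LinearMap.range_comp_of_range_eq_top]
  exact LinearMap.range_eq_top.2 hs

theorem map_range_transition {s t r : ℝ} (h : s ≤ t) (h' : t ≤ r) :
    (LinearMap.range (transition M h)).map (transition M h') =
      LinearMap.range (transition M (h.trans h')) := by
  rw [← transition_comp h h', LinearMap.range_comp]

theorem rank_eq {s t : ℝ} (h : s ≤ t) :
    rank M s t = Module.finrank F (LinearMap.range (transition M h)) := by
  simp [rank, h]

/-- Older classes at `r` are generated by images that factor through `t`. This is why a class that
has merged with an older one stays merged. -/
theorem map_older {b t r : ℝ} (h : b ≤ t) (h' : t ≤ r) :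
    (older M h).map (transition M h') = older M (h.trans h') := by
  simp only [older, Submodule.map_iSup, map_range_transition]

theorem older_le_range {b t : ℝ} (h : b ≤ t) : older M h ≤ LinearMap.range (transition M h) :=
  iSup₂_le fun _ hs => range_transition_le hs.le h

variable (M) in
/-- The classes in `M_b` that are older than `b` at the parameter `t`. -/
def dead {b t : ℝ} (h : b ≤ t) : Submodule F (M.obj b) :=
  (older M h).comap (transition M h)

theorem mem_dead {b t : ℝ} {h : b ≤ t} {x : M.obj b} :
    x ∈ dead M h ↔ transition M h x ∈ older M h := Iff.rfl

theorem dead_mono {b t r : ℝ} (h : b ≤ t) (h' : t ≤ r) : dead M h ≤ dead M (h.trans h') := by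
  intro x hx
  rw [mem_dead, ← transition_transition h h', ← map_older h h']
  exact Submodule.mem_map_of_mem hx

/-- A class that is dead at `r` is dead at every earlier parameter from which the transition to
`r` is injective. -/
theorem dead_eq {b t r : ℝ} (h : b ≤ t) (h' : t ≤ r)
    (hi : Function.Injective (transition M h')) : dead M h = dead M (h.trans h') := by
  refine le_antisymm (dead_mono h h') fun x hx => ?_
  rw [mem_dead, ← transition_transition h h', ← map_older h h'] at hx
  obtain ⟨z, hz, hzx⟩ := hx
  rw [mem_dead, ← hi hzx]
  exact hz

theorem dead_refl (b : ℝ) : dead M (le_refl b) = older M (le_refl b) := by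
  ext x
  rw [mem_dead, transition_refl]

/-- The parameter at which a class dies. -/
def death {b : ℝ} (y : M.obj b) : EReal :=
  ⨅ (t : ℝ) (h : b ≤ t) (_ : transition M h y ∈ older M h), (t : EReal)

theorem death_lt_iff {b : ℝ} {y : M.obj b} {d : EReal} :
    death y < d ↔ ∃ (t : ℝ) (h : b ≤ t), y ∈ dead M h ∧ (t : EReal) < d := by
  simp only [death, iInf_lt_iff, mem_dead, exists_prop]

theorem death_le {b t : ℝ} {y : M.obj b} (h : b ≤ t) (hy : y ∈ dead M h) : death y ≤ t :=
  iInf_le_of_le t (iInf_le_of_le h (iInf_le _ hy))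

theorem le_death {b : ℝ} (y : M.obj b) : (b : EReal) ≤ death y :=
  le_iInf fun _ => le_iInf fun h => le_iInf fun _ => EReal.coe_le_coe_iff.2 h

theorem death_eq_of_older {b : ℝ} {y : M.obj b} (hy : y ∈ older M (le_refl b)) :
    death y = b :=
  le_antisymm (death_le le_rfl (by rwa [dead_refl])) (le_death y)

/-- The dead classes at successive parameters form an increasing family of subspaces, and `death`
records when a class enters it. -/
theorem isUltrametric_death {b : ℝ} : IsUltrametric F (death : M.obj b → EReal) where
  add_le x y := by
    refine le_of_forall_gt fun d hd => ?_
    obtain ⟨t, ht, hxt, htd⟩ := death_lt_iff.1 ((le_max_left _ _).trans_lt hd)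
    obtain ⟨r, hr, hyr, hrd⟩ := death_lt_iff.1 ((le_max_right _ _).trans_lt hd)
    rcases le_total t r with h | h
    · exact death_lt_iff.2 ⟨r, hr, Submodule.add_mem _ (dead_mono ht h hxt) hyr, hrd⟩
    · exact death_lt_iff.2 ⟨t, ht, Submodule.add_mem _ hxt (dead_mono hr h hyr), htd⟩
  smul_le a x := by
    refine le_of_forall_gt fun d hd => ?_
    obtain ⟨t, ht, hxt, htd⟩ := death_lt_iff.1 hd
    exact death_lt_iff.2 ⟨t, ht, Submodule.smul_mem _ a hxt, htd⟩

/-! ### Tame modules: multiplicities as jumps in the dimension of the dead classes -/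

variable (M) in
/-- A pointwise finite-dimensional persistence module that is locally constant on both sides of
every parameter and eventually constant. -/
structure IsTame : Prop where
  finite : ∀ t, Module.Finite F (M.obj t)
  left : ∀ t : ℝ, ∃ l < t, ∀ (s s' : ℝ) (h : s ≤ s'), l < s → s' < t →
    Function.Bijective (transition M h)
  right : ∀ t : ℝ, ∃ l > t, ∀ (s s' : ℝ) (h : s ≤ s'), t < s → s' < l →
    Function.Bijective (transition M h)
  top : ∃ l : ℝ, ∀ (s s' : ℝ) (h : s ≤ s'), l < s → Function.Bijective (transition M h)

variable (M) in
/-- The persistence module does not change immediately after `b`. -/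
def IsRightContinuousAt (b : ℝ) : Prop :=
  ∃ l > b, ∀ (s : ℝ) (h : b ≤ s), s < l → Function.Bijective (transition M h)

/-- The infimum defining `death` need not be attained in general. Here a class dead just after `t`
is dead at `t`, because the transition in between is injective. -/
theorem IsRightContinuousAt.mem_dead_of_death_le {b t : ℝ} (ht : IsRightContinuousAt M t)
    (h : b ≤ t) {y : M.obj b} (hy : death y ≤ t) : y ∈ dead M h := by
  obtain ⟨l, hl, hbij⟩ := ht
  obtain ⟨r, hr, hyr, hrl⟩ := death_lt_iff.1 (hy.trans_lt (EReal.coe_lt_coe_iff.2 hl))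
  rcases le_total r t with hrt | htr
  · exact dead_mono hr hrt hyr
  · rw [dead_eq h htr (hbij r htr (EReal.coe_lt_coe_iff.1 hrl)).1]
    exact hyr

theorem IsRightContinuousAt.death_le_iff {b : ℝ} (hb : IsRightContinuousAt M b) {y : M.obj b} :
    death y ≤ b ↔ y ∈ older M (le_refl b) :=
  ⟨fun h => (dead_refl (M := M) b).le (hb.mem_dead_of_death_le le_rfl h), fun h => (death_eq_of_older h).le⟩

/-- Rank-nullity applied twice to `M_b → M_t`: on all of `M_b`, and on the dead classes, which
contain the kernel and map onto the older classes. -/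
theorem finrank_dead {b t : ℝ} (h : b ≤ t) [Module.Finite F (M.obj b)] :
    Module.finrank F (dead M h) + rank M b t =
      Module.finrank F (M.obj b) + Module.finrank F (older M h) := by
  have h1 := finrank_map_add_finrank_inf_ker (transition M h) (dead M h)
  have h2 := LinearMap.finrank_range_add_finrank_ker (transition M h)
  rw [dead, Submodule.map_comap_eq, inf_eq_right.2 (older_le_range h),
    inf_eq_right.2 (LinearMap.ker_le_comap _)] at h1
  rw [rank_eq h, dead]
  omega

theorem rank_mono_left {s s' c : ℝ} [Module.Finite F (M.obj c)] (h : s ≤ s') (h' : s' ≤ c) :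
    rank M s c ≤ rank M s' c := by
  rw [rank_eq (h.trans h'), rank_eq h']
  exact Submodule.finrank_mono (range_transition_le h h')

/-- The Frobenius rank inequality for a persistence module. -/
theorem rank_add_rank_le {s s' c d : ℝ} [Module.Finite F (M.obj c)] (h : s ≤ s') (h' : s' ≤ c)
    (h'' : c ≤ d) : rank M s c + rank M s' d ≤ rank M s' c + rank M s d := by
  have h1 := finrank_map_add_finrank_inf_ker (transition M h'')
    (LinearMap.range (transition M (h.trans h')))
  have h2 := finrank_map_add_finrank_inf_ker (transition M h'') (LinearMap.range (transition M h'))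
  rw [map_range_transition] at h1 h2
  rw [rank_eq (h.trans h'), rank_eq (h'.trans h''), rank_eq h', rank_eq ((h.trans h').trans h'')]
  -- Each rank drop from `c` to `d` is the dimension of a range intersected with one fixed kernel,
  -- hence grows with the range.
  have h3 := Submodule.finrank_mono (inf_le_inf_right (LinearMap.ker (transition M h''))
    (range_transition_le (M := M) h h'))
  omega

/-- Near `b`, the ranks determine the dimension of the space of dead classes. -/
theorem IsTame.exists_finrank_dead (hM : IsTame M) {b : ℝ} (hb : IsRightContinuousAt M b)
    {d : EReal} (hd : (b : EReal) < d) :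
    ∃ a₀ b₀ : ℝ, a₀ < b ∧ b < b₀ ∧ (b₀ : EReal) < d ∧ ∀ a b' t : ℝ, a₀ ≤ a → a < b → b < b' →
      b' ≤ b₀ → b' ≤ t → ∀ h : b ≤ t, Module.finrank F (dead M h) + rank M b' t =
        Module.finrank F (M.obj b) + rank M a t := by
  have := hM.finite
  obtain ⟨l, hl, hleft⟩ := hM.left b
  obtain ⟨r, hr, hright⟩ := hb
  obtain ⟨a₀, hla, hab⟩ := exists_between hl
  obtain ⟨b₀, hbb, hbr⟩ := EReal.lt_iff_exists_real_btwn.1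
    (lt_min (EReal.coe_lt_coe_iff.2 hr) hd)
  rw [EReal.coe_lt_coe_iff] at hbb
  refine ⟨a₀, b₀, hab, hbb, hbr.trans_le (min_le_right _ _), ?_⟩
  have hbr' : b₀ < r := EReal.coe_lt_coe_iff.1 (hbr.trans_le (min_le_left _ _))
  intro a b' t haa ha hb1 hb2 hbt h
  rw [rank_eq hbt, ← range_transition_eq hb1.le hbt (hright b' hb1.le (by linarith)).2,
    ← rank_eq h, finrank_dead, rank_eq (ha.le.trans h)]
  -- The module is constant just below `b`, so the image of the single space `M_a` already contains
  -- every older class.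
  refine congrArg (fun S : Submodule F (M.obj t) => Module.finrank F (M.obj b) +
    Module.finrank F S) (le_antisymm ?_ ?_)
  · refine iSup₂_le fun s hs => ?_
    rcases le_total s a with hsa | has
    · exact range_transition_le hsa (ha.le.trans h)
    · rw [range_transition_eq has (hs.le.trans h) (hleft a s has (by linarith) hs).2]
  · exact le_iSup₂_of_le a ha le_rfl

theorem multiplicity_add_finrank (hM : IsTame M) {b : ℝ} (hb : IsRightContinuousAt M b)
    {d : EReal} (hd : (b : EReal) < d) {A B : Submodule F (M.obj b)}
    (hA : ∀ x, x ∈ A ↔ death x ≤ d) (hB : ∀ x, x ∈ B ↔ death x < d) :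
    multiplicity M b d + Module.finrank F B = Module.finrank F A := by
  have := hM.finite
  obtain ⟨a₀, b₀, ha₀, hb₀, hbd, hnear⟩ := hM.exists_finrank_dead hb hd
  induction d with
  | bot => simp at hd
  | top =>
    obtain ⟨l, hl⟩ := hM.top
    have hAtop : A = ⊤ := Submodule.eq_top_iff'.2 fun x => (hA x).2 le_top
    have hBc : ∀ (c : ℝ) (h : b ≤ c), l < c → dead M h = B := by
      intro c h hlc
      ext x
      rw [hB, death_lt_iff]
      refine ⟨fun hx => ⟨c, h, hx, EReal.coe_lt_top c⟩, ?_⟩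
      rintro ⟨t, ht, hxt, -⟩
      rcases le_total t c with htc | hct
      · exact dead_mono ht htc hxt
      · rw [dead_eq h hct (hl _ _ hct hlc).1]
        exact hxt
    -- Beyond `l` nothing changes, so being dead at such a `c` means having finite death.
    set c₀ := max b₀ (l + 1) with hc₀
    have hval : ∀ a b' c : ℝ, a₀ ≤ a → a < b → b < b' → b' ≤ b₀ → c₀ ≤ c →
        rank M b' c - rank M a c + Module.finrank F B = Module.finrank F A := by
      intro a b' c h1 h2 h3 h4 h5
      have hbc : b' ≤ c := h4.trans ((le_max_left _ _).trans h5)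
      have h6 := hnear a b' c h1 h2 h3 h4 hbc (h3.le.trans hbc)
      rw [hBc c _ (by have := (le_max_right b₀ (l + 1)).trans h5; linarith)] at h6
      rw [hAtop, finrank_top]
      have := rank_mono_left (M := M) (h2.le.trans h3.le) hbc
      omega
    have key : multiplicity M b ⊤ = rank M b₀ c₀ - rank M a₀ c₀ := by
      apply le_antisymm
      · exact Nat.sInf_le ⟨a₀, b₀, c₀, ha₀, hb₀, le_max_left _ _, EReal.coe_lt_top _,
          .inr ⟨rfl, rfl⟩⟩
      · refine le_csInf ⟨_, a₀, b₀, c₀, ha₀, hb₀, le_max_left _ _, EReal.coe_lt_top _,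
          .inr ⟨rfl, rfl⟩⟩ ?_
        rintro m ⟨a, b', c, h1, h2, h3, -, ⟨d', h4, -⟩ | ⟨-, rfl⟩⟩
        · exact absurd h4 not_top_lt
        · have e1 := hval a₀ b₀ c₀ le_rfl ha₀ hb₀ le_rfl le_rfl
          -- An arbitrary rectangle is clipped to the range where the count is known; clipping
          -- cannot increase the count.
          have e2 := hval (max a a₀) (min b' b₀) (max c c₀) (le_max_right _ _) (max_lt h1 ha₀)
            (lt_min h2 hb₀) (min_le_right _ _) (le_max_right _ _)
          have hab : max a a₀ ≤ min b' b₀ := ((max_lt h1 ha₀).trans (lt_min h2 hb₀)).le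
          have hbc : min b' b₀ ≤ c := (min_le_left _ _).trans h3
          have e3 := rank_mono_left (M := M) (min_le_left b' b₀) h3
          have e4 := rank_mono_left (M := M) (le_max_left a a₀) (hab.trans hbc)
          have e5 := rank_add_rank_le (M := M) hab hbc (le_max_left c c₀)
          omega
    rw [key]
    exact hval a₀ b₀ c₀ le_rfl ha₀ hb₀ le_rfl le_rfl
  | coe d =>
    rw [EReal.coe_lt_coe_iff] at hd hbd
    obtain ⟨l, hl, hleft⟩ := hM.left d
    obtain ⟨r, hr, hright⟩ := hM.right d
    obtain ⟨c₀, hlc₀, hcd₀⟩ := exists_between (max_lt hl hbd)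
    obtain ⟨d₀, hdd₀, hdr₀⟩ := exists_between hr
    have hbc₀ : b₀ < c₀ := (le_max_right _ _).trans_lt hlc₀
    -- Just before `d` the dead classes are those with death `< d`; just after `d` they are those
    -- with death `≤ d`. The rectangle count is the difference of the two dimensions.
    have hBc : ∀ (c : ℝ) (h : b ≤ c), c₀ ≤ c → c < d → dead M h = B := by
      intro c h hlc hcd
      ext x
      rw [hB, death_lt_iff]
      refine ⟨fun hx => ⟨c, h, hx, EReal.coe_lt_coe_iff.2 hcd⟩, ?_⟩
      rintro ⟨t, ht, hxt, htd⟩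
      rcases le_total t c with htc | hct
      · exact dead_mono ht htc hxt
      · rw [dead_eq h hct (hleft _ _ hct (((le_max_left _ _).trans_lt hlc₀).trans_le hlc)
          (EReal.coe_lt_coe_iff.1 htd)).1]
        exact hxt
    have hAd : ∀ (d' : ℝ) (h : b ≤ d'), d < d' → d' ≤ d₀ → dead M h = A := by
      intro d' h hdd' hd'
      ext x
      rw [hA]
      constructor
      · intro hx
        refine le_of_forall_gt fun e he => ?_
        obtain ⟨t, hdt, hte⟩ := EReal.lt_iff_exists_real_btwn.1
          (lt_min he (EReal.coe_lt_coe_iff.2 hdd'))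
        rw [EReal.coe_lt_coe_iff] at hdt
        have htd' : t < d' := EReal.coe_lt_coe_iff.1 (hte.trans_le (min_le_right _ _))
        refine death_lt_iff.2 ⟨t, hd.le.trans hdt.le, ?_, hte.trans_le (min_le_left _ _)⟩
        rw [dead_eq (hd.le.trans hdt.le) htd'.le (hright _ _ htd'.le hdt (by linarith)).1]
        exact hx
      · intro hx
        obtain ⟨t, ht, hxt, htd⟩ := death_lt_iff.1 (hx.trans_lt (EReal.coe_lt_coe_iff.2 hdd'))
        exact dead_mono ht (EReal.coe_lt_coe_iff.1 htd).le hxt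
    have hval : ∀ a b' c d' : ℝ, a₀ ≤ a → a < b → b < b' → b' ≤ b₀ → c₀ ≤ c → c < d → d < d' →
        d' ≤ d₀ → rank M b' c + rank M a d' - (rank M a c + rank M b' d') +
          Module.finrank F B = Module.finrank F A := by
      intro a b' c d' h1 h2 h3 h4 h5 h6 h7 h8
      have hbc : b' ≤ c := h4.trans (hbc₀.le.trans h5)
      have hbd' : b' ≤ d' := hbc.trans (h6.trans h7).le
      have e1 := hnear a b' c h1 h2 h3 h4 hbc (h3.le.trans hbc)
      have e2 := hnear a b' d' h1 h2 h3 h4 hbd' (h3.le.trans hbd')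
      rw [hBc c _ h5 h6] at e1
      rw [hAd d' _ h7 h8] at e2
      have := rank_add_rank_le (M := M) (h2.le.trans h3.le) hbc (h6.trans h7).le
      omega
    have hval₀ := hval a₀ b₀ c₀ d₀ le_rfl ha₀ hb₀ le_rfl le_rfl hcd₀ hdd₀ le_rfl
    have hmem : ∃ a b' c : ℝ, a < b ∧ b < b' ∧ b' ≤ c ∧ (c : EReal) < (d : EReal) ∧
        ((∃ d' : ℝ, (d : EReal) < (d' : EReal) ∧
          rank M b₀ c₀ + rank M a₀ d₀ - (rank M a₀ c₀ + rank M b₀ d₀) =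
            rank M b' c + rank M a d' - (rank M a c + rank M b' d')) ∨
          ((d : EReal) = ⊤ ∧ rank M b₀ c₀ + rank M a₀ d₀ - (rank M a₀ c₀ + rank M b₀ d₀) =
            rank M b' c - rank M a c)) :=
      ⟨a₀, b₀, c₀, ha₀, hb₀, hbc₀.le, EReal.coe_lt_coe_iff.2 hcd₀,
        .inl ⟨d₀, EReal.coe_lt_coe_iff.2 hdd₀, rfl⟩⟩
    have key : multiplicity M b d =
        rank M b₀ c₀ + rank M a₀ d₀ - (rank M a₀ c₀ + rank M b₀ d₀) := by
      refine le_antisymm (Nat.sInf_le hmem) (le_csInf ⟨_, hmem⟩ ?_)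
      rintro m ⟨a, b', c, h1, h2, h3, h4, ⟨d', h5, rfl⟩ | ⟨h, -⟩⟩
      · rw [EReal.coe_lt_coe_iff] at h4 h5
        have e2 := hval (max a a₀) (min b' b₀) (max c c₀) (min d' d₀) (le_max_right _ _)
          (max_lt h1 ha₀) (lt_min h2 hb₀) (min_le_right _ _) (le_max_right _ _) (max_lt h4 hcd₀)
          (lt_min h5 hdd₀) (min_le_right _ _)
        have hab : max a a₀ ≤ min b' b₀ := ((max_lt h1 ha₀).trans (lt_min h2 hb₀)).le
        have hbc : min b' b₀ ≤ c := (min_le_left _ _).trans h3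
        have hcd : max c c₀ ≤ min d' d₀ := ((max_lt h4 hcd₀).trans (lt_min h5 hdd₀)).le
        have hcd' : c ≤ d' := (h4.trans h5).le
        -- `e3` to `e6` say that the four strips cut off by the clipping count nonnegatively; `e7`
        -- says it for the clipped rectangle, so its truncated subtraction is exact.
        have e3 := rank_add_rank_le (M := M) (le_max_left a a₀) (hab.trans hbc) hcd'
        have e4 := rank_add_rank_le (M := M) (min_le_left b' b₀) h3 hcd'
        have e5 := rank_add_rank_le (M := M) hab hbc (le_max_left c c₀)
        have e6 := rank_add_rank_le (M := M) hab
          ((hbc.trans (le_max_left c c₀)).trans hcd) (min_le_left d' d₀)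
        have e7 := rank_add_rank_le (M := M) hab (hbc.trans (le_max_left c c₀)) hcd
        omega
      · exact absurd h (EReal.coe_ne_top d)
    rw [key]
    exact hval₀

theorem multiplicity_eq_zero {b : ℝ} {d : EReal} (hd : d ≤ b) : multiplicity M b d = 0 := by
  rw [multiplicity]
  -- No rectangle satisfies `b < b' ≤ c < d`, and the infimum of the empty set of naturals is `0`.
  convert Nat.sInf_empty
  refine Set.eq_empty_of_forall_notMem ?_
  rintro m ⟨a, b', c, -, h2, h3, h4, -⟩
  exact absurd (h4.trans_le hd) (not_lt.2 (EReal.coe_le_coe_iff.2 (h2.le.trans h3)))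

/-- An adapted basis of `M_b` contains as many vectors with death `d` as the multiplicity of the
dot `(b,d)` says. -/
theorem card_death_eq (hM : IsTame M) {b : ℝ} (hb : IsRightContinuousAt M b) {Q : Type*}
    [AddCommGroup Q] [Module F Q] (f : Q ≃ₗ[F] M.obj b) {κ : Type*} [Fintype κ]
    (e : Module.Basis κ F Q) (he : IsAdapted (F := F) (fun x => death (f x)) e) {d : EReal}
    (hd : (b : EReal) < d) : Nat.card {i // death (f (e i)) = d} = multiplicity M b d := by
  have hv := (isUltrametric_death (M := M) (b := b))
  have h0 : death (0 : M.obj b) < d := by rwa [death_eq_of_older (Submodule.zero_mem _)]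
  have h1 := multiplicity_add_finrank hM hb hd (A := hv.sublevel d h0.le)
    (B := hv.strictSublevel d h0) (fun _ => Iff.rfl) (fun _ => Iff.rfl)
  have h2 := card_fiber_of_adapted e he (A := (hv.sublevel d h0.le).comap f.toLinearMap)
    (B := (hv.strictSublevel d h0).comap f.toLinearMap) (d := d)
    (fun _ => Iff.rfl) (fun _ => Iff.rfl)
  have h3 : ∀ S : Submodule F (M.obj b),
      Module.finrank F (S.comap f.toLinearMap) = Module.finrank F S := fun S =>
    (f.ofSubmodule' S).finrank_eq
  rw [h3, h3] at h2
  omega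

/-- The dots with birth `b` are matched with the vectors of an adapted basis that are not older
than `b`. -/
theorem exists_equiv_dotsAt (hM : IsTame M) {b : ℝ} (hb : IsRightContinuousAt M b) {Q : Type*}
    [AddCommGroup Q] [Module F Q] (f : Q ≃ₗ[F] M.obj b) {κ : Type*} [Fintype κ]
    (e : Module.Basis κ F Q) (he : IsAdapted (F := F) (fun x => death (f x)) e) :
    ∃ σ : DotsAt M b ≃ {i // f (e i) ∉ older M (le_refl b)},
      ∀ p, p.1 = death (f (e (σ p))) := by
  classical
  have key : ∀ d : EReal, Nonempty (Fin (multiplicity M b d) ≃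
      {j : {i // f (e i) ∉ older M (le_refl b)} // death (f (e j)) = d}) := by
    intro d
    -- For `d ≤ b` both sides are empty, since by right-continuity a class dying by `b` is older
    -- than `b`. For `d > b` the restriction to non-older vectors is automatic, since older ones die
    -- exactly at `b`.
    rcases le_or_gt d b with hd | hd
    · rw [multiplicity_eq_zero hd]
      refine ⟨@Equiv.equivOfIsEmpty _ _ _ ⟨?_⟩⟩
      rintro ⟨⟨i, hi⟩, h⟩
      exact hi (hb.death_le_iff.1 (h.le.trans hd))
    · rw [← card_death_eq hM hb f e he hd]
      refine ⟨(Finite.equivFin _).symm.trans (Equiv.subtypeSubtypeEquivSubtype ?_).symm⟩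
      intro i hi hold
      rw [death_eq_of_older hold] at hi
      exact hd.ne hi
  let g := fun d => (key d).some
  refine ⟨(Equiv.sigmaCongrRight g).trans (Equiv.sigmaFiberEquiv fun
    j : {i // f (e i) ∉ older M (le_refl b)} => death (f (e j))), fun p => ?_⟩
  exact (g p.1 p.2).2.symm

/-- Persistence modules that agree at `b`, with the same older classes, have compatible systems of
representatives for the dots born at `b`. -/
theorem exists_compatible_dots (hM : IsTame M) (hN : IsTame N) {b : ℝ}
    (hMb : IsRightContinuousAt M b) (hNb : IsRightContinuousAt N b) (f : M.obj b →ₗ[F] N.obj b)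
    (hf : Function.Bijective f)
    (hold : ∀ x, f x ∈ older N (le_refl b) ↔ x ∈ older M (le_refl b)) :
    ∃ (Φ : DotsAt M b ≃ DotsAt N b) (y : DotsAt M b → M.obj b),
      LinearIndependent F (fun p => (older M (le_refl b)).mkQ (y p)) ∧
      Submodule.span F (Set.range (fun p => (older M (le_refl b)).mkQ (y p))) = ⊤ ∧
      (∀ p, DiesAt M (y p) p.1) ∧ ∀ p, DiesAt N (f (y p)) (Φ p).1 := by
  have := hM.finite
  obtain ⟨e, hev, hew⟩ := exists_adapted_basis _ (isUltrametric_death (M := M) (b := b))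
    ((isUltrametric_death (M := N) (b := b)).comp f) rfl
  obtain ⟨σ, hσ⟩ := exists_equiv_dotsAt hM hMb (LinearEquiv.refl F _) e hev
  obtain ⟨τ, hτ⟩ := exists_equiv_dotsAt hN hNb (LinearEquiv.ofBijective f hf) e hew
  simp only [LinearEquiv.refl_apply] at σ hσ
  simp only [LinearEquiv.ofBijective_apply] at τ hτ
  -- Both diagrams are indexed by the same non-older vectors of the common basis, so `Φ` passes from
  -- a dot to its vector and back to the other diagram.
  let θ : {i // e i ∉ older M (le_refl b)} ≃ {i // f (e i) ∉ older N (le_refl b)} :=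
    Equiv.subtypeEquivRight fun i => not_congr (hold (e i)).symm
  obtain ⟨hli, hspan⟩ := linearIndependent_mkQ_of_adapted e (older M (le_refl b))
    fun a i hi hx => hMb.death_le_iff.1 ((hev a i hi).trans (hMb.death_le_iff.2 hx))
  refine ⟨(σ.trans θ).trans τ.symm, fun p => e (σ p), hli.comp σ σ.injective, ?_, hσ, fun p => ?_⟩
  · rw [← hspan]
    exact congrArg _ (σ.surjective.range_comp
      fun i : {i // e i ∉ older M (le_refl b)} => (older M (le_refl b)).mkQ (e i))
  · obtain ⟨q, hq⟩ := τ.surjective (θ (σ p))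
    have h1 : ((σ.trans θ).trans τ.symm) p = q := τ.symm_apply_eq.2 hq.symm
    have h2 : e (τ q) = e (σ p) := by rw [hq]; rfl
    rw [h1]
    beta_reduce
    rw [← h2]
    exact hτ q

end Persistence

/-! ### Filtrations of finite complexes -/

section Order

variable {P : Type*} [PartialOrder P] {f : ℝ → P}

/-- A monotone map with finite range attains a maximal value on `(-∞, t)`, and keeps it from there
on. -/
theorem exists_eq_left (hf : Monotone f) (hfin : (Set.range f).Finite) (t : ℝ) :
    ∃ l < t, ∀ s s' : ℝ, s ≤ s' → l < s → s' < t → f s = f s' := by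
  obtain ⟨l, hl, hmax⟩ := (hfin.subset (Set.image_subset_range f (Set.Iio t))).exists_maximalFor'
    f _ ⟨t - 1, by simp⟩
  have key : ∀ s, l < s → s < t → f s = f l := fun s h h' =>
    le_antisymm (hmax h' (hf h.le)) (hf h.le)
  exact ⟨l, hl, fun s s' h h1 h2 =>
    (key s h1 (h.trans_lt h2)).trans (key s' (h1.trans_le h) h2).symm⟩

theorem exists_eq_right (hf : Monotone f) (hfin : (Set.range f).Finite) (t : ℝ) :
    ∃ l > t, ∀ s s' : ℝ, s ≤ s' → t < s → s' < l → f s = f s' := by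
  obtain ⟨l, hl, hmin⟩ := (hfin.subset (Set.image_subset_range f (Set.Ioi t))).exists_minimalFor'
    f _ ⟨t + 1, by simp⟩
  have key : ∀ s, t < s → s < l → f s = f l := fun s h h' =>
    le_antisymm (hf h'.le) (hmin h (hf h'.le))
  exact ⟨l, hl, fun s s' h h1 h2 =>
    (key s h1 (h.trans_lt h2)).trans (key s' (h1.trans_le h) h2).symm⟩

theorem exists_eq_top (hf : Monotone f) (hfin : (Set.range f).Finite) :
    ∃ l : ℝ, ∀ s s' : ℝ, s ≤ s' → l < s → f s = f s' := by
  obtain ⟨l, -, hmax⟩ := (hfin.subset (Set.image_subset_range f Set.univ)).exists_maximalFor'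
    f _ Set.univ_nonempty
  have key : ∀ s, l < s → f s = f l := fun s h =>
    le_antisymm (hmax trivial (hf h.le)) (hf h.le)
  exact ⟨l, fun s s' h h1 => (key s h1).trans (key s' (h1.trans_le h)).symm⟩

end Order

section Homology

variable {F : Type v} [Field F] {V : Type u} {S T U : PreAbstractSimplicialComplex V}

theorem finite_setOf_faces_subset (X : Finset V) :
    {S : PreAbstractSimplicialComplex V | ∀ Y ∈ S, Y ⊆ X}.Finite := by
  refine Set.Finite.of_finite_image (f := fun S => S.faces)
    ((X.powerset.finite_toSet).finite_subsets.subset ?_) fun S _ T _ h => SetLike.coe_injective h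
  rintro _ ⟨S, hS, rfl⟩ Y hY
  exact Finset.mem_coe.2 (Finset.mem_powerset.2 (hS Y hY))

theorem finite_chains {X : Finset V} (hS : ∀ Y ∈ S, Y ⊆ X) (n : ℕ) :
    Module.Finite F (chains F S n) := by
  refine Module.Finite.span_of_finite F ?_
  have : {x : Fin (n + 1) → V | ∀ i, x i ∈ X}.Finite := by
    convert Set.Finite.pi (fun _ : Fin (n + 1) => X.finite_toSet) using 1
    ext x
    simp
  refine (this.image fun x => Chain.single F x 1).subset ?_
  rintro _ ⟨x, ⟨Y, hY, hx⟩, rfl⟩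
  refine ⟨x, fun i => hS Y hY ?_, rfl⟩
  rw [← Finset.mem_coe, hx]
  exact Set.mem_range_self i

theorem cycles_le_chains (n : ℕ) : cycles F S n ≤ chains F S n := by
  cases n with
  | zero => exact le_rfl
  | succ n => exact inf_le_left

theorem finite_homology {X : Finset V} (hS : ∀ Y ∈ S, Y ⊆ X) (n : ℕ) :
    Module.Finite F (Homology F n S) := by
  have := finite_chains (F := F) hS n
  have := Submodule.finiteDimensional_of_le (cycles_le_chains (F := F) (S := S) n)
  infer_instance

theorem homologyMap_homologyMap (n : ℕ) (h : S ≤ T) (h' : T ≤ U) (x : Homology F n S) :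
    homologyMap F n h' (homologyMap F n h x) = homologyMap F n (h.trans h') x := by
  induction x using Submodule.Quotient.induction_on
  rfl

theorem homologyMap_refl (n : ℕ) (h : S ≤ S) (x : Homology F n S) : homologyMap F n h x = x := by
  induction x using Submodule.Quotient.induction_on
  rfl

theorem homologyMap_bijective (n : ℕ) (h : S ≤ T) (hST : S = T) :
    Function.Bijective (homologyMap F n h) := by
  subst hST
  rw [show ⇑(homologyMap F n h) = id from funext (homologyMap_refl n h)]
  exact Function.bijective_id

/-- The homology of a filtration. -/
abbrev filtrationHomology (F : Type v) [Field F] (n : ℕ) {f : ℝ → PreAbstractSimplicialComplex V}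
    (hf : Monotone f) : ℝ ⥤ ModuleCat.{max u v} F :=
  hf.functor ⋙ homologyFunctor F V n

/-- Only finitely many complexes have all faces inside `X`, so the filtration is a step function and
its homology changes only where the complex does. -/
theorem isTame_filtrationHomology {X : Finset V} {f : ℝ → PreAbstractSimplicialComplex V}
    (hf : Monotone f) (hX : ∀ t, ∀ Y ∈ f t, Y ⊆ X) (n : ℕ) :
    IsTame (filtrationHomology F n hf) := by
  have hfin : (Set.range f).Finite := (finite_setOf_faces_subset X).subset (by
    rintro _ ⟨t, rfl⟩
    exact hX t)
  refine ⟨fun t => finite_homology (hX t) n, fun t => ?_, fun t => ?_, ?_⟩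
  · obtain ⟨l, hl, h⟩ := exists_eq_left hf hfin t
    exact ⟨l, hl, fun s s' hs h1 h2 => homologyMap_bijective n (hf hs) (h s s' hs h1 h2)⟩
  · obtain ⟨l, hl, h⟩ := exists_eq_right hf hfin t
    exact ⟨l, hl, fun s s' hs h1 h2 => homologyMap_bijective n (hf hs) (h s s' hs h1 h2)⟩
  · obtain ⟨l, h⟩ := exists_eq_top hf hfin
    exact ⟨l, fun s s' hs h1 => homologyMap_bijective n (hf hs) (h s s' hs h1)⟩

theorem isRightContinuousAt_filtrationHomology {f : ℝ → PreAbstractSimplicialComplex V}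
    (hf : Monotone f) (n : ℕ) {b : ℝ} (h : ∃ l > b, ∀ s, b ≤ s → s < l → f b = f s) :
    IsRightContinuousAt (filtrationHomology F n hf) b := by
  obtain ⟨l, hl, h⟩ := h
  exact ⟨l, hl, fun s hs h1 => homologyMap_bijective n (hf hs) (h s hs h1)⟩

end Homology

/-! ### The ambient Rips complex -/

section Rips

variable {V : Type u} [MetricSpace V] {k : BallKind} {X : Finset V} {K : Set V}

theorem edist_le_eVariationOn {x y : V} (γ : Path x y) :
    edist x y ≤ eVariationOn γ Set.univ := by
  simpa using eVariationOn.edist_le (γ : unitInterval → V) (s := Set.univ) (x := 0) (y := 1)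
    trivial trivial

theorem IsGeodesicSpace.mem_ball_univ_iff (hV : IsGeodesicSpace V) {x z : V} {α : ℝ}
    (hα : 0 ≤ α) : z ∈ ball k Set.univ x α ↔ dist x z ≤ α := by
  cases k with
  | ambient => rw [dist_comm]; exact Iff.rfl
  | intrinsic =>
    rw [← ENNReal.ofReal_le_ofReal_iff hα, ← edist_dist]
    constructor
    · rintro ⟨γ, -, hγ⟩
      exact (edist_le_eVariationOn γ).trans hγ
    · intro h
      obtain ⟨γ, hγ⟩ := hV x z
      exact ⟨γ, fun _ => trivial, hγ.le.trans h⟩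

theorem IsGeodesicSpace.exists_midpoint (hV : IsGeodesicSpace V) (x y : V) :
    ∃ z, dist x z ≤ dist x y / 2 ∧ dist y z ≤ dist x y / 2 := by
  obtain ⟨γ, hγ⟩ := hV x y
  have hcont : Continuous fun t => dist x (γ t) := by fun_prop
  -- The geodesic crosses half the distance by the intermediate value theorem. Additivity of length
  -- then leaves at most the other half for the rest.
  obtain ⟨t, ht⟩ : dist x y / 2 ∈ Set.range fun t => dist x (γ t) := by
    refine mem_range_of_exists_le_of_exists_ge hcont ⟨0, ?_⟩ ⟨1, ?_⟩
    · simpa using div_nonneg (dist_nonneg (x := x) (y := y)) zero_le_two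
    · simp
  have h1 := eVariationOn.edist_le (γ : unitInterval → V) (s := Set.univ ∩ Set.Iic t)
    (x := 0) (y := t) ⟨trivial, Set.mem_Iic.2 unitInterval.nonneg'⟩ ⟨trivial, Set.self_mem_Iic⟩
  have h2 := eVariationOn.edist_le (γ : unitInterval → V) (s := Set.univ ∩ Set.Ici t)
    (x := t) (y := 1) ⟨trivial, Set.self_mem_Ici⟩ ⟨trivial, Set.mem_Ici.2 unitInterval.le_one'⟩
  have h3 := eVariationOn.union (γ : unitInterval → V)
    (⟨⟨trivial, Set.self_mem_Iic⟩, fun _ h => h.2⟩ : IsGreatest (Set.univ ∩ Set.Iic t) t)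
    (⟨⟨trivial, Set.self_mem_Ici⟩, fun _ h => h.2⟩ : IsLeast (Set.univ ∩ Set.Ici t) t)
  rw [← Set.inter_union_distrib_left, Set.Iic_union_Ici, Set.univ_inter, hγ] at h3
  rw [γ.source] at h1
  rw [γ.target] at h2
  have h4 : edist x (γ t) + edist (γ t) y ≤ edist x y := (add_le_add h1 h2).trans h3.ge
  rw [edist_dist, edist_dist, edist_dist, ← ENNReal.ofReal_add dist_nonneg dist_nonneg,
    ENNReal.ofReal_le_ofReal_iff dist_nonneg] at h4
  refine ⟨γ t, ht.le, ?_⟩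
  rw [dist_comm y]
  have : dist x (γ t) = dist x y / 2 := ht
  linarith

/-- Midpoints exist, so two balls of radius `α` meet exactly when their centres are at most `2 * α`
apart, for either kind of ball. This condition is closed in `α`, which makes the filtration
right-continuous. -/
theorem IsGeodesicSpace.mem_rips_univ_iff (hV : IsGeodesicSpace V) {Y : Finset V} {α : ℝ} :
    Y ∈ rips k X Set.univ α ↔
      Y.Nonempty ∧ Y ⊆ X ∧ 0 ≤ α ∧ ∀ x ∈ Y, ∀ y ∈ Y, x ≠ y → dist x y ≤ 2 * α := by
  refine and_congr_right fun _ => and_congr_right fun _ => and_congr_right fun hα =>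
    forall₅_congr fun x _ y _ _ => ?_
  constructor
  · rintro ⟨z, ⟨hx, hy⟩, -⟩
    rw [hV.mem_ball_univ_iff hα] at hx hy
    have := dist_triangle_right x y z
    linarith
  · intro h
    obtain ⟨z, hx, hy⟩ := hV.exists_midpoint x y
    exact ⟨z, ⟨(hV.mem_ball_univ_iff hα).2 (by linarith),
      (hV.mem_ball_univ_iff hα).2 (by linarith)⟩, trivial⟩

theorem subset_of_mem_rips {α : ℝ} : ∀ Y ∈ rips k X K α, Y ⊆ X := fun _ h => h.2.1

theorem IsGeodesicSpace.exists_rips_eq (hV : IsGeodesicSpace V) (b : ℝ) :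
    ∃ l > b, ∀ s, b ≤ s → s < l → rips k X Set.univ b = rips k X Set.univ s := by
  obtain ⟨l, hl, h⟩ := exists_eq_right (rips_mono (k := k) (X := X) (K := Set.univ))
    ((finite_setOf_faces_subset X).subset (by rintro _ ⟨t, rfl⟩; exact subset_of_mem_rips)) b
  refine ⟨l, hl, fun s hbs hsl => le_antisymm (rips_mono hbs) fun Y hY => ?_⟩
  rcases hbs.eq_or_lt with rfl | hbs
  · exact hY
  have hY' : ∀ t, b < t → t ≤ s → Y ∈ rips k X Set.univ t := fun t h1 h2 => by
    rw [h t s h2 h1 hsl]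
    exact hY
  have hY₀ := hV.mem_rips_univ_iff.1 hY
  refine hV.mem_rips_univ_iff.2 ⟨hY₀.1, hY₀.2.1, ?_, fun x hx y hy hxy => ?_⟩
  · refine le_of_forall_gt_imp_ge_of_dense fun t ht => ?_
    refine (hV.mem_rips_univ_iff.1 (hY' (min t s) (lt_min ht hbs) (min_le_right _ _))).2.2.1.trans
      (min_le_left _ _)
  · have : dist x y / 2 ≤ b := by
      refine le_of_forall_gt_imp_ge_of_dense fun t ht => ?_
      have h1 := (hV.mem_rips_univ_iff.1
        (hY' (min t s) (lt_min ht hbs) (min_le_right _ _))).2.2.2 x hx y hy hxy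
      have h2 := min_le_left t s
      linarith
    linarith

end Rips

/-! ### The Matching Lemma -/

section Matching

variable {V : Type u} [MetricSpace V] {F : Type v} [Field F] {k : BallKind} {X : Finset V}
  {K : Set V}

/-- The Rips-like path with `ε = 0` up to the parameter `l` and `ε = e` beyond. -/
def stepPath (l e : ℝ) (hl : 0 ≤ l) (he : 0 ≤ e) : RipsLikePath where
  eps t := if t ≤ l then 0 else e
  mono s _ t _ hst := by
    by_cases ht : t ≤ l
    · simp [ht, hst.trans ht]
    · by_cases hs : s ≤ l <;> simp [ht, hs, he]
  zero := by simp [hl]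

/-- Classes of `L` and `R` that correspond to each other along `lam`-LSM are simultaneously
older than `b`. -/
theorem toHR_mem_older_iff {L : RipsLikePath} {b : ℝ}
    (hL : ∀ t ≤ b, L.filtration k X K t = rips k X Set.univ t) (n : ℕ)
    (x : (HL F n k X K L).obj b) :
    toHR F n k X K L b x ∈ older (HR F n k X) (le_refl b) ↔
      x ∈ older (HL F n k X K L) (le_refl b) := by
  have hbij : ∀ t ≤ b, Function.Bijective (toHR F n k X K L t) := fun t ht =>
    homologyMap_bijective n _ (hL t ht)
  have hmap : (older (HL F n k X K L) (le_refl b)).map (toHR F n k X K L b) =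
      older (HR F n k X) (le_refl b) := by
    simp only [older, Submodule.map_iSup]
    refine iSup_congr fun s => iSup_congr fun hs => ?_
    have hcomm : toHR F n k X K L b ∘ₗ transition (HL F n k X K L) (hs.le.trans (le_refl b)) =
        transition (HR F n k X) (hs.le.trans (le_refl b)) ∘ₗ toHR F n k X K L s := by
      refine LinearMap.ext fun z => ?_
      exact (homologyMap_homologyMap n ((L.filtration k X K).monotone hs.le)
        (parallax_le_rips b _) z).trans
        (homologyMap_homologyMap n (parallax_le_rips s _) (rips_mono hs.le) z).symm
    rw [← LinearMap.range_comp, hcomm, LinearMap.range_comp_of_range_eq_top]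
    exact LinearMap.range_eq_top.2 (hbij s hs.le).2
  rw [← hmap, ← Submodule.mem_comap,
    Submodule.comap_map_eq_of_injective (hbij b le_rfl).1]

/-- A class that is dead at `δ` in `R` is dead at `ω` in `L`. -/
theorem dead_of_homologicallyMatched {L : RipsLikePath} {b lam δ ω : ℝ} (hb : b ≤ lam)
    (hlδ : lam ≤ δ) (hδω : δ ≤ ω)
    (hL : ∀ t ≤ lam, L.filtration k X K t = rips k X Set.univ t) (n : ℕ) {e₁ : ℝ}
    (h₁ : 0 ≤ lam → L.eps lam ≤ e₁) (h₂ : 0 ≤ lam → e₁ ≤ L.eps ω)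
    (hker : (LinearMap.ker (homologyMap F n (rips_mono (k := k) (X := X) (K := Set.univ)
        hlδ))).comap (homologyMap F n (parallax_le_rips (k := k) (X := X) (K := K) lam e₁)) ≤
      LinearMap.ker (homologyMap F n (parallax_mono (k := k) (X := X) (K := K)
        (hlδ.trans hδω) h₂)))
    {y : (HL F n k X K L).obj b}
    (hy : toHR F n k X K L b y ∈ dead (HR F n k X) (hb.trans hlδ)) :
    y ∈ dead (HL F n k X K L) (hb.trans (hlδ.trans hδω)) := by
  rw [mem_dead, ← map_older (le_refl b) (hb.trans hlδ)] at hy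
  rw [mem_dead, ← map_older (le_refl b) (hb.trans (hlδ.trans hδω))]
  obtain ⟨z', hz', hzy⟩ := hy
  obtain ⟨z, rfl⟩ : ∃ z, toHR F n k X K L b z = z' :=
    (homologyMap_bijective n (parallax_le_rips b (L.eps b)) (hL b hb)).2 z'
  -- `z` is an older class with the same image as `y` in `HR_δ`; the difference is the class to
  -- which the kernel condition applies.
  let x : Homology F n (L.filtration k X K b) := (z - y : (HL F n k X K L).obj b)
  refine ⟨z, (toHR_mem_older_iff (fun t ht => hL t (ht.trans hb)) n z).1 hz', ?_⟩
  have hzero : homologyMap F n ((parallax_le_rips b (L.eps b)).trans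
      (rips_mono (k := k) (X := X) (K := Set.univ) (hb.trans hlδ))) x = 0 := by
    have h : transition (HR F n k X) (hb.trans hlδ) (toHR F n k X K L b (z - y)) = 0 := by
      rw [map_sub, map_sub, hzy, sub_self]
    exact (homologyMap_homologyMap n (parallax_le_rips b (L.eps b))
      (rips_mono (hb.trans hlδ)) x).symm.trans h
  have hmono : L.filtration k X K b ≤ L.filtration k X K lam := (L.filtration k X K).monotone hb
  have hle : L.filtration k X K lam ≤ parallax k X K lam e₁ := parallax_mono le_rfl h₁
  -- The class is moved from `L_b` through `L_lam` into `P_{lam,e₁}`, where `hker` applies;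
  -- functoriality identifies its image in `HR_δ` with the zero class of `hzero`.
  have hmem : homologyMap F n (parallax_mono (hlδ.trans hδω) h₂)
      (homologyMap F n (hmono.trans hle) x) = 0 :=
    hker ((congrArg _ (homologyMap_homologyMap n (hmono.trans hle)
      (parallax_le_rips lam e₁) x)).trans
        ((homologyMap_homologyMap n _ (rips_mono hlδ) x).trans hzero))
  have h2 : transition (HL F n k X K L) (hb.trans (hlδ.trans hδω)) (z - y) = 0 :=
    (homologyMap_homologyMap n (hmono.trans hle) (parallax_mono (hlδ.trans hδω) h₂) x).symm.trans
      hmem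
  rwa [map_sub, sub_eq_zero] at h2

end Matching

end Parallax

end

theorem mainTheorem5 {V : Type u} [MetricSpace V] (hV : Parallax.IsGeodesicSpace V)
    (F : Type v) [Field F] (k : Parallax.BallKind)
    (X : Finset V) (K : Set V) (hK : Parallax.IsModel X K)
    (hX : ∀ x ∈ X, ∀ y ∈ X, ∀ x' ∈ X, ∀ y' ∈ X, x ≠ y → x' ≠ y' →
      dist x y = dist x' y' → s(x, y) = s(x', y'))
    (lam δ ω : ℝ) (hHM : Parallax.HomologicallyMatched F k X K lam δ ω) :
    ∃ L : Parallax.RipsLikePath, ∀ n : ℕ, ∀ b ≤ lam,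
      ∃ (Φ : Parallax.DotsAt (Parallax.HL F n k X K L) b ≃ Parallax.DotsAt (Parallax.HR F n k X) b)
        (y : Parallax.DotsAt (Parallax.HL F n k X K L) b → (Parallax.HL F n k X K L).obj b),
        LinearIndependent F
          (fun p => (Parallax.older (Parallax.HL F n k X K L) (le_refl b)).mkQ (y p)) ∧
        Submodule.span F (Set.range
          (fun p => (Parallax.older (Parallax.HL F n k X K L) (le_refl b)).mkQ (y p))) = ⊤ ∧
        (∀ p, Parallax.DiesAt (Parallax.HL F n k X K L) (y p) p.1) ∧
        (∀ p, Parallax.DiesAt (Parallax.HR F n k X) (Parallax.toHR F n k X K L b (y p)) (Φ p).1) ∧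
        (∀ p, (ω : EReal) < p.1 → (δ : EReal) < (Φ p).1) := by
  obtain ⟨h0, hsup, hsup', hδω, ε₁, ε₂, hε₁, hε, hker⟩ := hHM
  -- The strict inequality `lam < l` leaves room to the right of every `b ≤ lam`, so that `L`
  -- inherits right-continuity at `b` from `R`.
  obtain ⟨l, hlsm, hl⟩ : ∃ l : ℝ, Parallax.LSM k X K l ∧ lam < l := by
    obtain ⟨l, hl⟩ := lt_iSup_iff.1 hsup
    obtain ⟨hlsm, hl⟩ := lt_iSup_iff.1 hl
    exact ⟨l, hlsm, EReal.coe_lt_coe_iff.1 hl⟩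
  have hlδ : l < δ := EReal.coe_lt_coe_iff.1
    ((le_iSup₂_of_le l hlsm le_rfl : (l : EReal) ≤ Parallax.lamSup k X K).trans_lt hsup')
  -- The jump to `ε₂` takes place after `l`, and `l < δ ≤ ω` ensures that it has happened by `ω`.
  obtain ⟨L, heps, rfl⟩ : ∃ L : Parallax.RipsLikePath, (∀ t ≤ l, L.eps t = 0) ∧ L.eps ω = ε₂ :=
    ⟨Parallax.stepPath l ε₂ (h0.trans hl.le) (hε₁.trans hε), fun t ht => if_pos ht,
      if_neg (not_le.2 (hlδ.trans_le hδω))⟩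
  have hL : ∀ t ≤ l, L.filtration k X K t = Parallax.rips k X Set.univ t := fun t ht => by
    rw [← hlsm t ht]
    exact congrArg (Parallax.parallax k X K t) (heps t ht)
  refine ⟨L, fun n b hb => ?_⟩
  have hM : Parallax.IsTame (Parallax.HL F n k X K L) :=
    Parallax.isTame_filtrationHomology (X := X) (L.filtration k X K).monotone
      (fun t Y hY => Parallax.subset_of_mem_rips Y hY.1) n
  have hN : Parallax.IsTame (Parallax.HR F n k X) :=
    Parallax.isTame_filtrationHomology _ (fun _ => Parallax.subset_of_mem_rips) n
  have hNr : ∀ t, Parallax.IsRightContinuousAt (Parallax.HR F n k X) t := fun t =>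
    Parallax.isRightContinuousAt_filtrationHomology _ n (hV.exists_rips_eq t)
  have hMb : Parallax.IsRightContinuousAt (Parallax.HL F n k X K L) b := by
    refine Parallax.isRightContinuousAt_filtrationHomology _ n ?_
    obtain ⟨r, hr, h⟩ := hV.exists_rips_eq (k := k) (X := X) b
    refine ⟨min r l, lt_min hr (hb.trans_lt hl), fun s hbs hs => ?_⟩
    rw [hL b (hb.trans hl.le), hL s (hs.le.trans (min_le_right _ _))]
    exact h s hbs (hs.trans_le (min_le_left _ _))
  obtain ⟨Φ, y, hli, hspan, hy, hΦ⟩ := Parallax.exists_compatible_dots hM hN hMb (hNr b)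
    (Parallax.toHR F n k X K L b)
    (Parallax.homologyMap_bijective n _ (hL b (hb.trans hl.le)))
    (Parallax.toHR_mem_older_iff (fun t ht => hL t (ht.trans (hb.trans hl.le))) n)
  refine ⟨Φ, y, hli, hspan, hy, hΦ, fun p hp => not_le.1 fun hle => not_le.2 hp ?_⟩
  rw [hΦ p] at hle
  rw [hy p]
  -- Right-continuity of `R` at `δ` turns death at most `δ` into being dead at `δ` itself, as the
  -- kernel condition requires.
  have hdead := (hNr δ).mem_dead_of_death_le (hb.trans (hl.trans hlδ).le) hle
  exact Parallax.death_le _ (Parallax.dead_of_homologicallyMatched hb (hl.trans hlδ).le hδω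
    (fun t ht => hL t (ht.trans hl.le)) n (e₁ := ε₁) (fun _ => (heps lam hl.le).trans_le hε₁)
    (fun _ => hε) (hker n) hdead)
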